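/- Let $n\ge 1$ be an integer and let $r_1,r_2>0$. For $r>0$ let $S_r^{2n-1}=\{z\in\mathbb C^n:|z|=r\}$. Let $\mu$ be a finite complex Borel measure on $\mathbb C^n$ that is supported on $S_{r_1}^{2n-1}$ and absolutely continuous with respect to the surface measure of $S_{r_1}^{2n-1}$. For an integer $k\ge 0$ let $$L_k^{n-1}(x)=\sum_{j=0}^k\binom{n-1+k}{k-j}\frac{(-x)^j}{j!},\qquad \varphi_k^{n-1}(z)=L_k^{n-1}\!\left(\tfrac{|z|^2}{2}\right)e^{-|z|^2/4}\quad(z\in\mathbb C^n),$$ and define the $k$-th spectral projection of $\mu$ by $$(\varphi_k^{n-1}\times\mu)(z)=\int_{S_{r_1}^{2n-1}}\varphi_k^{n-1}(z-\omega)\,e^{\frac i2\operatorname{Im}(z\cdot\bar\omega)}\,d\mu(\omega),\qquad z\in\mathbb C^n,$$ where $z\cdot\bar\omega=\sum_{j=1}^n z_j\overline{\omega_j}$. If $(\varphi_k^{n-1}\times\mu)(z)=0$ for all $z\in S_{r_2}^{2n-1}$ and all integers $k\ge 0$, then $\mu=0$. -/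

import Mathlib

open MeasureTheory
open scoped ComplexConjugate

noncomputable section

/-- The Laguerre polynomial `L_k^m(x) = ∑_{j ≤ k} binom(m + k, k - j) (-x)^j / j!` of degree `k`
and order `m ∈ ℕ`. -/
def laguerrePoly (m k : ℕ) (x : ℝ) : ℝ :=
  ∑ j ∈ Finset.range (k + 1), ((m + k).choose (k - j) : ℝ) * (-x) ^ j / (j.factorial : ℝ)

/-- The Laguerre function `φ_k^{n-1}(z) = L_k^{n-1}(|z|² / 2) e^{-|z|² / 4}` on `ℂⁿ`, `n ≥ 1`. -/
def laguerreFun (n k : ℕ) (z : EuclideanSpace ℂ (Fin n)) : ℝ :=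
  laguerrePoly (n - 1) k (‖z‖ ^ 2 / 2) * Real.exp (-(‖z‖ ^ 2 / 4))

/-- The surface measure on the sphere of radius `r > 0` centred at the origin of `ℂⁿ = ℝ²ⁿ`, as a
Borel measure on `ℂⁿ`: the image under `ω ↦ r ω` of `r ^ (2n - 1)` times the surface measure of the
unit sphere. -/
def sphereSurfaceMeasure (n : ℕ) (r : ℝ) : Measure (EuclideanSpace ℂ (Fin n)) :=
  ENNReal.ofReal (r ^ (2 * n - 1)) •
    ((volume : Measure (EuclideanSpace ℂ (Fin n))).toSphere).map
      (fun ω : Metric.sphere (0 : EuclideanSpace ℂ (Fin n)) 1 =>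
        r • (ω : EuclideanSpace ℂ (Fin n)))

/-- The class `X(S_r^{2n-1})` of finite complex Borel measures on `ℂⁿ` which are supported on the
sphere of radius `r` and absolutely continuous with respect to its surface measure. -/
structure IsACSphereMeasure (n : ℕ) (r : ℝ) (μ : ComplexMeasure (EuclideanSpace ℂ (Fin n))) :
    Prop where
  supported : ∀ s : Set (EuclideanSpace ℂ (Fin n)), MeasurableSet s →
    Disjoint s (Metric.sphere 0 r) → μ s = 0
  absolutelyContinuous :
    VectorMeasure.AbsolutelyContinuous μ (sphereSurfaceMeasure n r).toENNRealVectorMeasure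

/-- The spectral projection
`(φ_k^{n-1} × μ)(z) = ∫ φ_k^{n-1}(z - ω) e^{(i/2) Im(z · ω̄)} dμ(ω)` of a complex measure `μ`
on `ℂⁿ`, where `z · ω̄ = ∑ j, z_j ω̄_j`. The last argument of `integral` is the pairing,
multiplication of complex numbers. -/
def spectralProjection (n k : ℕ) (μ : ComplexMeasure (EuclideanSpace ℂ (Fin n)))
    (z : EuclideanSpace ℂ (Fin n)) : ℂ :=
  VectorMeasure.integral μ
    (fun ω => (laguerreFun n k (z - ω) : ℂ) *
      Complex.exp (Complex.I / 2 * ((∑ j, z j * conj (ω j)).im : ℂ)))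
    (ContinuousLinearMap.mul ℝ ℂ)

end

/-!
On the sphere `|ω| = r₁`, with `|z| = r₂` and `w = z · ω̄`, the kernel of the `k`-th projection is
`L_k(x) exp (-x / 2 + (w - w̄) / 4)`, where `x = |z - ω|² / 2 = (r₁² + r₂² - w - w̄) / 2`. The
Laguerre polynomials span all polynomials, so `L_k` may be replaced by any entire function; taking
`exp ((1/2 - 2τ) x)` shows that `exp ((τ + 1/4) w + (τ - 1/4) w̄)` has integral zero for every `τ`.
Rotating `z ↦ ζ z`, `|ζ| = 1`, and continuing analytically in `ζ`, the same holds for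
`exp (ζ (τ + 1/4) w + ζ⁻¹ (τ - 1/4) w̄)` and all `ζ ≠ 0`. The parameters can be chosen so that both
coefficients equal a given `s ≠ 0`; for imaginary `s` the function `exp (s (w + w̄))` is a character
of the underlying real Hilbert space, so the Fourier transform of `μ` vanishes.
-/

open Finset Metric
open Polynomial (C X aeval)
open scoped BoundedContinuousFunction InnerProductSpace

section BanachAlgebra

theorem map_aeval_mul_eq_zero {K A M : Type*} [Field K] [CommRing A] [Algebra K A]
    [AddCommGroup M] [Module K M] (S : Polynomial.Sequence K) (Λ : A →ₗ[K] M) {x b : A}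
    (h : ∀ k, Λ (aeval x (S k) * b) = 0) (p : Polynomial K) : Λ (aeval x p * b) = 0 := by
  have hspan : Submodule.span K (Set.range S) = ⊤ := S.span fun k ↦
    (Polynomial.leadingCoeff_ne_zero.2 (S.ne_zero k)).isUnit
  exact LinearMap.congr_fun (LinearMap.ext_on_range
    (f := Λ ∘ₗ LinearMap.mulRight K b ∘ₗ (aeval x).toLinearMap) (g := 0) hspan h) p

theorem map_exp_smul_mul_eq_zero {𝕜 A F : Type*} [RCLike 𝕜] [NormedRing A] [NormedAlgebra 𝕜 A]
    [CompleteSpace A] [NormedAddCommGroup F] [NormedSpace 𝕜 F] (Λ : A →L[𝕜] F) {x b : A}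
    (h : ∀ i, Λ (x ^ i * b) = 0) (t : 𝕜) : Λ (NormedSpace.exp (t • x) * b) = 0 := by
  have hsum := ((NormedSpace.exp_series_hasSum_exp' (𝕂 := 𝕜) (t • x)).mul_right b).mapL Λ
  simp only [smul_pow, smul_mul_assoc, map_smul, h, smul_zero] at hsum
  exact hsum.unique hasSum_zero

theorem eqOn_compl_zero_of_eqOn_sphere {F : Type*} [NormedAddCommGroup F] [NormedSpace ℂ F]
    {f : ℂ → F} (hf : AnalyticOnNhd ℂ f {0}ᶜ) (h : Set.EqOn f 0 (sphere 0 1)) :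
    Set.EqOn f 0 {0}ᶜ := by
  have hrank : 1 < Module.rank ℝ ℂ := by simp
  have hacc : AccPt (1 : ℂ) (.principal (sphere 0 1)) :=
    (isPreconnected_sphere hrank 0 1).preperfect_of_nontrivial
      ⟨1, by simp, -1, by simp, by norm_num⟩ 1 (by simp)
  exact hf.eqOn_zero_of_preconnected_of_frequently_eq_zero
    (isConnected_compl_singleton_of_one_lt_rank hrank 0).isPreconnected one_ne_zero
    ((accPt_iff_frequently_nhdsNE.1 hacc).mono h)

variable {A F : Type*} [NormedCommRing A] [NormedAlgebra ℂ A] [CompleteSpace A]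
  [NormedAddCommGroup F] [NormedSpace ℂ F] (Λ : A →L[ℂ] F) {w w' : A}

theorem map_exp_smul_add_inv_smul_eq_zero
    (h : ∀ ζ : ℂ, ‖ζ‖ = 1 → Λ (NormedSpace.exp (ζ • w + ζ⁻¹ • w')) = 0) {ζ : ℂ} (hζ : ζ ≠ 0) :
    Λ (NormedSpace.exp (ζ • w + ζ⁻¹ • w')) = 0 := by
  have hf : AnalyticOnNhd ℂ (fun ζ : ℂ ↦ Λ (NormedSpace.exp (ζ • w + ζ⁻¹ • w'))) {0}ᶜ :=
    fun ζ hζ ↦ (Λ.analyticAt _).comp ((NormedSpace.exp_analytic (𝕂 := ℂ) _).comp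
      ((analyticAt_id.smul analyticAt_const).add ((analyticAt_inv hζ).smul analyticAt_const)))
  exact eqOn_compl_zero_of_eqOn_sphere hf (fun ζ hζ ↦ h ζ (mem_sphere_zero_iff_norm.1 hζ)) hζ

theorem map_exp_smul_add_eq_zero (c : ℂ)
    (h : ∀ τ ζ : ℂ, ‖ζ‖ = 1 →
      Λ (NormedSpace.exp (ζ • (τ + c) • w + ζ⁻¹ • (τ - c) • w')) = 0) (s : ℂ) :
    Λ (NormedSpace.exp (s • (w + w'))) = 0 := by
  have hexp : Continuous (NormedSpace.exp : A → A) :=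
    continuous_iff_continuousAt.2 fun a ↦ (NormedSpace.exp_analytic (𝕂 := ℂ) a).continuousAt
  have hcont : Continuous fun s : ℂ ↦ Λ (NormedSpace.exp (s • (w + w'))) :=
    Λ.continuous.comp (hexp.comp (by fun_prop))
  refine congr_fun (hcont.ext_on (dense_compl_singleton 0) continuous_const fun s hs ↦ ?_) s
  have hs0 : s ≠ 0 := hs
  obtain ⟨τ, hτ⟩ := IsAlgClosed.exists_pow_nat_eq (s ^ 2 + c ^ 2) two_pos
  have hprod : (τ + c) * (τ - c) = s * s := by linear_combination hτ
  have hτc : τ + c ≠ 0 := left_ne_zero_of_mul (hprod ▸ mul_ne_zero hs0 hs0)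
  have hzero := map_exp_smul_add_inv_smul_eq_zero Λ (h τ) (div_ne_zero hs0 hτc)
  rwa [smul_smul, smul_smul, div_mul_cancel₀ _ hτc, inv_div, div_mul_eq_mul_div, hprod,
    mul_div_cancel_right₀ _ hs0, ← smul_add] at hzero

end BanachAlgebra

section Laguerre

/-- The Laguerre polynomials of order `m`, with complex coefficients, as a sequence of polynomials
indexed by their degree. -/
noncomputable def laguerreSequence (m : ℕ) : Polynomial.Sequence ℂ where
  elems' k := ∑ j ∈ range (k + 1),
    C (((m + k).choose (k - j) : ℂ) * (-1) ^ j / (j.factorial : ℂ)) * X ^ j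
  degree_eq' k := by
    refine Polynomial.degree_eq_of_le_of_coeff_ne_zero ?_ ?_
    · exact (Polynomial.degree_sum_le _ _).trans (Finset.sup_le fun j hj ↦
        (Polynomial.degree_C_mul_X_pow_le j _).trans
          (by exact_mod_cast mem_range_succ_iff.1 hj))
    · simp [Polynomial.finsetSum_coeff, Nat.factorial_ne_zero]

theorem eval_laguerreSequence (m k : ℕ) (x : ℝ) :
    (laguerreSequence m k).eval (x : ℂ) = laguerrePoly m k x := by
  change Polynomial.eval (x : ℂ) (∑ j ∈ range (k + 1),
    C (((m + k).choose (k - j) : ℂ) * (-1) ^ j / (j.factorial : ℂ)) * X ^ j) = _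
  simp only [laguerrePoly, Polynomial.eval_finsetSum, Polynomial.eval_mul,
    Polynomial.eval_C, Polynomial.eval_pow, Polynomial.eval_X]
  push_cast
  refine sum_congr rfl fun j _ ↦ ?_
  rw [neg_pow]
  ring

end Laguerre

section ComplexMeasure

variable {X : Type*} [MeasurableSpace X] {f : X → ℂ}

theorem complexMeasure_variation_re_le (μ : ComplexMeasure X) :
    (ComplexMeasure.re μ).variation ≤ μ.variation :=
  VectorMeasure.variation_le_of_forall_enorm_le fun E _ ↦
    (enorm_le_iff_norm_le.2 (Complex.abs_re_le_norm (μ E))).trans (μ.enorm_measure_le_variation E)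

theorem complexMeasure_variation_im_le (μ : ComplexMeasure X) :
    (ComplexMeasure.im μ).variation ≤ μ.variation :=
  VectorMeasure.variation_le_of_forall_enorm_le fun E _ ↦
    (enorm_le_iff_norm_le.2 (Complex.abs_im_le_norm (μ E))).trans (μ.enorm_measure_le_variation E)

theorem complexMeasure_variation_le_re_add_im (μ : ComplexMeasure X) :
    μ.variation ≤ (ComplexMeasure.re μ).variation + (ComplexMeasure.im μ).variation := by
  refine VectorMeasure.variation_le_of_forall_enorm_le fun E _ ↦ ?_
  have hnorm : ‖μ E‖ₑ ≤ ‖ComplexMeasure.re μ E‖ₑ + ‖ComplexMeasure.im μ E‖ₑ := calc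
    ‖μ E‖ₑ = ‖((μ E).re : ℂ) + (μ E).im * Complex.I‖ₑ := by rw [Complex.re_add_im]
    _ ≤ ‖((μ E).re : ℂ)‖ₑ + ‖((μ E).im : ℂ) * Complex.I‖ₑ := enorm_add_le _ _
    _ = ‖(μ E).re‖ₑ + ‖(μ E).im‖ₑ := by simp [← ofReal_norm]
  exact hnorm.trans (add_le_add (VectorMeasure.enorm_measure_le_variation _ E)
    (VectorMeasure.enorm_measure_le_variation _ E))

instance signedMeasure_isFiniteMeasure_variation (s : SignedMeasure X) :
    IsFiniteMeasure s.variation := by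
  rw [← SignedMeasure.totalVariation_eq_variation]
  infer_instance

instance complexMeasure_isFiniteMeasure_variation (μ : ComplexMeasure X) :
    IsFiniteMeasure μ.variation :=
  isFiniteMeasure_of_le _ (complexMeasure_variation_le_re_add_im μ)

theorem signedMeasure_integral_eq_sub (s : SignedMeasure X) (hf : Integrable f s.variation) :
    ∫ᵛ x, f x ∂<•s =
      ∫ x, f x ∂s.toJordanDecomposition.posPart - ∫ x, f x ∂s.toJordanDecomposition.negPart := by
  rw [← SignedMeasure.totalVariation_eq_variation] at hf
  obtain ⟨hpos, hneg⟩ := integrable_add_measure.1 hf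
  conv_lhs => rw [← s.toSignedMeasure_toJordanDecomposition]
  rw [JordanDecomposition.toSignedMeasure, VectorMeasure.integral_sub_vectorMeasure,
    VectorMeasure.integral_toSignedMeasure, VectorMeasure.integral_toSignedMeasure]
  · rwa [VectorMeasure.Integrable, Measure.variation_toSignedMeasure]
  · rwa [VectorMeasure.Integrable, Measure.variation_toSignedMeasure]

theorem signedMeasure_integral_conj (s : SignedMeasure X) (hf : Integrable f s.variation) :
    ∫ᵛ x, conj (f x) ∂<•s = conj (∫ᵛ x, f x ∂<•s) := by
  have hconj : Integrable (fun x ↦ conj (f x)) s.variation :=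
    Complex.conjCLE.toContinuousLinearMap.integrable_comp hf
  rw [signedMeasure_integral_eq_sub s hf, signedMeasure_integral_eq_sub s hconj, map_sub,
    integral_conj, integral_conj]

theorem complexMeasure_integral_eq_re_add_im (μ : ComplexMeasure X) (hf : μ.Integrable f) :
    ∫ᵛ x, f x ∂[ContinuousLinearMap.mul ℝ ℂ; μ] =
      ∫ᵛ x, f x ∂<•(ComplexMeasure.re μ) +
        Complex.I * ∫ᵛ x, f x ∂<•(ComplexMeasure.im μ) := by
  have hre : (ComplexMeasure.re μ).Integrable f :=
    hf.mono_measure (complexMeasure_variation_re_le μ)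
  have him : (ComplexMeasure.im μ).Integrable f :=
    hf.mono_measure (complexMeasure_variation_im_le μ)
  have hmul := VectorMeasure.continuousLinearMap_apply_integral (μ := ComplexMeasure.im μ)
    (B := (ContinuousLinearMap.lsmul ℝ ℝ).flip) (C := ContinuousLinearMap.mul ℝ ℂ Complex.I) him
  rw [ContinuousLinearMap.mul_apply'] at hmul
  rw [hmul]
  refine setToFun_add_left'' (fun s _ _ ↦ ContinuousLinearMap.ext fun x ↦ ?_) hre him
    (complexMeasure_variation_le_re_add_im μ) (by positivity) (by positivity) (by positivity)
  change x * μ s = (μ s).re • x + Complex.I * ((μ s).im • x)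
  rw [Complex.real_smul, Complex.real_smul]
  linear_combination -x * Complex.re_add_im (μ s)

theorem complexMeasure_integral_const_mul (μ : ComplexMeasure X) (c : ℂ) (hf : μ.Integrable f) :
    ∫ᵛ x, c * f x ∂[ContinuousLinearMap.mul ℝ ℂ; μ] =
      c * ∫ᵛ x, f x ∂[ContinuousLinearMap.mul ℝ ℂ; μ] := by
  have hcomp := VectorMeasure.integral_continuousLinearMap_comp (μ := μ)
    (B := ContinuousLinearMap.mul ℝ ℂ) (C := ContinuousLinearMap.mul ℝ ℂ c) hf
  have happly := VectorMeasure.continuousLinearMap_apply_integral (μ := μ)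
    (B := ContinuousLinearMap.mul ℝ ℂ) (C := ContinuousLinearMap.mul ℝ ℂ c) hf
  simp only [ContinuousLinearMap.mul_apply'] at hcomp happly
  rw [hcomp, happly]
  congr 1
  ext x y
  exact mul_assoc c x y

theorem exists_vectorMeasure_map_subtypeVal_eq {M : Type*} [AddCommMonoid M] [TopologicalSpace M]
    [T2Space M] [ContinuousAdd M] (μ : VectorMeasure X M) {K : Set X} (hK : MeasurableSet K)
    (hμ : ∀ s, MeasurableSet s → Disjoint s K → μ s = 0) :
    ∃ ν : VectorMeasure K M, ν.map Subtype.val = μ := by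
  have hemb := MeasurableEmbedding.subtype_coe hK
  refine ⟨⟨fun s ↦ μ (Subtype.val '' s), ?_, fun s hs ↦ ?_, fun s hs hdisj ↦ ?_⟩, ?_⟩
  · simp
  · exact μ.not_measurable (hemb.measurableSet_image.not.2 hs)
  · rw [Set.image_iUnion]
    exact μ.m_iUnion (fun i ↦ hemb.measurableSet_image.2 (hs i)) fun i j hij ↦
      Set.disjoint_image_of_injective Subtype.val_injective (hdisj hij)
  · ext s hs
    rw [VectorMeasure.map_apply _ measurable_subtype_coe hs]
    change μ (Subtype.val '' (Subtype.val ⁻¹' s)) = μ s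
    rw [Subtype.image_preimage_coe, ← VectorMeasure.of_add_of_sdiff (hK.inter hs) hs
      Set.inter_subset_right, Set.sdiff_inter_self_eq_sdiff,
      hμ _ (hs.diff hK) Set.disjoint_sdiff_left, add_zero]

end ComplexMeasure

section Fourier

variable {E : Type*} [NormedAddCommGroup E] [InnerProductSpace ℝ E] [MeasurableSpace E]
  [BorelSpace E] [SecondCountableTopology E]

theorem integrable_cexp_inner_mul_I (ν : Measure E) [IsFiniteMeasure ν] (t : E) :
    Integrable (fun x ↦ Complex.exp (inner ℝ x t * Complex.I)) ν :=
  .of_bound (C := 1) (by fun_prop) (by simp [Complex.norm_exp_ofReal_mul_I])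

variable [CompleteSpace E]

theorem signedMeasure_eq_zero_of_fourier_eq_zero (s : SignedMeasure E)
    (h : ∀ t : E, ∫ᵛ x, Complex.exp (inner ℝ x t * Complex.I) ∂<•s = 0) : s = 0 := by
  have hparts : s.toJordanDecomposition.posPart = s.toJordanDecomposition.negPart :=
    Measure.ext_of_charFun (funext fun t ↦ by
      rw [charFun_apply, charFun_apply, ← sub_eq_zero, ← h t, signedMeasure_integral_eq_sub s
        (integrable_cexp_inner_mul_I _ t)])
  rw [← s.toSignedMeasure_toJordanDecomposition, JordanDecomposition.toSignedMeasure]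
  simp [hparts]

theorem complexMeasure_eq_zero_of_fourier_eq_zero (μ : ComplexMeasure E)
    (h : ∀ t : E, ∫ᵛ x, Complex.exp (inner ℝ x t * Complex.I) ∂[ContinuousLinearMap.mul ℝ ℂ; μ]
      = 0) : μ = 0 := by
  have hint (ν : Measure E) [IsFiniteMeasure ν] (t : E) := integrable_cexp_inner_mul_I ν t
  set F := fun t ↦ ∫ᵛ x, Complex.exp (inner ℝ x t * Complex.I) ∂<•(ComplexMeasure.re μ)
  set G := fun t ↦ ∫ᵛ x, Complex.exp (inner ℝ x t * Complex.I) ∂<•(ComplexMeasure.im μ)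
  have hadd (t : E) : F t + Complex.I * G t = 0 := by
    rw [← h t, complexMeasure_integral_eq_re_add_im μ (hint _ t)]
  have hF (t : E) : F (-t) = conj (F t) := by
    rw [← signedMeasure_integral_conj _ (hint _ t)]
    simp [F, ← Complex.exp_conj]
  have hG (t : E) : G (-t) = conj (G t) := by
    rw [← signedMeasure_integral_conj _ (hint _ t)]
    simp [G, ← Complex.exp_conj]
  have hsub (t : E) : F t - Complex.I * G t = 0 := by
    simpa [hF, hG, ← sub_eq_add_neg] using congrArg conj (hadd (-t))
  have hre : ComplexMeasure.re μ = 0 := signedMeasure_eq_zero_of_fourier_eq_zero _ fun t ↦ by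
    linear_combination (hadd t + hsub t) / 2
  have him : ComplexMeasure.im μ = 0 := signedMeasure_eq_zero_of_fourier_eq_zero _ fun t ↦
    mul_left_cancel₀ Complex.I_ne_zero (by linear_combination (hadd t - hsub t) / 2)
  exact (ComplexMeasure.equivSignedMeasureₗ (R := ℝ)).map_eq_zero_iff.1 (Prod.ext hre him)

end Fourier

section BoundedContinuousFunction

variable {X : Type*} [TopologicalSpace X]

/-- Evaluation at a point, as an algebra homomorphism on bounded continuous functions. -/
noncomputable def evalAlgHom (x : X) : (X →ᵇ ℂ) →ₐ[ℂ] ℂ :=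
  (ContinuousMap.evalAlgHom ℂ ℂ x).comp (BoundedContinuousFunction.toContinuousMapₐ ℂ)

theorem evalAlgHom_apply (x : X) (f : X →ᵇ ℂ) : evalAlgHom x f = f x := rfl

theorem boundedContinuousFunction_aeval_apply (f : X →ᵇ ℂ) (p : Polynomial ℂ) (x : X) :
    aeval f p x = p.eval (f x) := by
  rw [← evalAlgHom_apply, ← Polynomial.aeval_algHom_apply, evalAlgHom_apply,
    Polynomial.coe_aeval_eq_eval]

theorem boundedContinuousFunction_exp_apply (f : X →ᵇ ℂ) (x : X) :
    NormedSpace.exp f x = Complex.exp (f x) := by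
  rw [Complex.exp_eq_exp_ℂ]
  exact NormedSpace.map_exp (evalAlgHom x) (BoundedContinuousFunction.evalCLM ℂ x).continuous f

variable [MeasurableSpace X] [BorelSpace X]

theorem complexMeasure_integrable_boundedContinuousFunction (μ : ComplexMeasure X) (f : X →ᵇ ℂ) :
    μ.Integrable f :=
  .of_bound f.continuous.measurable.aestronglyMeasurable ‖f‖ (.of_forall f.norm_coe_le_norm)

/-- Integration against a complex measure, as a continuous linear functional on bounded continuous
functions. -/
noncomputable def integralCLM (μ : ComplexMeasure X) : (X →ᵇ ℂ) →L[ℂ] ℂ :=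
  LinearMap.mkContinuous
    { toFun f := ∫ᵛ x, f x ∂[ContinuousLinearMap.mul ℝ ℂ; μ]
      map_add' f g := VectorMeasure.integral_add
        (complexMeasure_integrable_boundedContinuousFunction μ f)
        (complexMeasure_integrable_boundedContinuousFunction μ g)
      map_smul' c f := complexMeasure_integral_const_mul μ c
        (complexMeasure_integrable_boundedContinuousFunction μ f) }
    (‖ContinuousLinearMap.mul ℝ ℂ‖ * μ.variation.real Set.univ) fun f ↦
      (VectorMeasure.norm_integral_le_of_norm_le_const
        (.of_forall f.norm_coe_le_norm)).trans_eq (by ring)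

theorem integralCLM_apply (μ : ComplexMeasure X) (f : X →ᵇ ℂ) :
    integralCLM μ f = ∫ᵛ x, f x ∂[ContinuousLinearMap.mul ℝ ℂ; μ] := rfl

end BoundedContinuousFunction

section TwistedConvolution

variable {E : Type*} [NormedAddCommGroup E] [InnerProductSpace ℂ E] {r : ℝ}

/-- The kernel `L_k^m(|z - ω|² / 2) e^{-|z - ω|² / 4} e^{(i/2) Im(z · ω̄)}` of the spectral
projections, in a complex inner product space, where `z · ω̄ = ⟪ω, z⟫` since Mathlib's inner product
is conjugate-linear in the first variable. The order `m` is not tied to the dimension. -/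
noncomputable def twistedLaguerreKernel (m k : ℕ) (z ω : E) : ℂ :=
  (laguerrePoly m k (‖z - ω‖ ^ 2 / 2) * Real.exp (-(‖z - ω‖ ^ 2 / 4)) : ℝ) *
    Complex.exp (Complex.I / 2 * ((inner ℂ ω z).im : ℂ))

theorem spectralProjection_eq_integral (n k : ℕ) (μ : ComplexMeasure (EuclideanSpace ℂ (Fin n)))
    (z : EuclideanSpace ℂ (Fin n)) : spectralProjection n k μ z =
      ∫ᵛ ω, twistedLaguerreKernel (n - 1) k z ω ∂[ContinuousLinearMap.mul ℝ ℂ; μ] := by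
  simp [spectralProjection, twistedLaguerreKernel, laguerreFun, PiLp.inner_apply]

/-- The function `ω ↦ z · ω̄ = ⟪ω, z⟫` on the sphere of radius `r`. -/
noncomputable def innerOnSphere (r : ℝ) (z : E) : sphere (0 : E) r →ᵇ ℂ :=
  BoundedContinuousFunction.ofNormedAddCommGroup (fun ω ↦ inner ℂ (ω : E) z) (by fun_prop)
    (r * ‖z‖) fun ω ↦ by
      simpa only [mem_sphere_zero_iff_norm.1 ω.2] using norm_inner_le_norm (𝕜 := ℂ) (ω : E) z

theorem innerOnSphere_apply (z : E) (ω : sphere (0 : E) r) :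
    innerOnSphere r z ω = inner ℂ (ω : E) z := rfl

theorem innerOnSphere_smul (c : ℂ) (z : E) :
    innerOnSphere r (c • z) = c • innerOnSphere r z := by
  ext ω
  simp [innerOnSphere_apply]

/-- The function `ω ↦ |z - ω|² / 2` on the sphere of radius `r`, written as
`(r² + |z|²) / 2 - Re (z · ω̄)`. -/
noncomputable def halfSqDistOnSphere (r : ℝ) (z : E) : sphere (0 : E) r →ᵇ ℂ :=
  algebraMap ℂ _ ((r ^ 2 + ‖z‖ ^ 2 : ℝ) / 2) -
    (2⁻¹ : ℂ) • (innerOnSphere r z + star (innerOnSphere r z))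

theorem halfSqDistOnSphere_apply (z : E) (ω : sphere (0 : E) r) :
    halfSqDistOnSphere r z ω = (‖z - ω‖ ^ 2 / 2 : ℝ) := by
  have hnorm : ‖z - ω‖ ^ 2 = r ^ 2 + ‖z‖ ^ 2 - 2 * (inner ℂ (ω : E) z).re := by
    rw [norm_sub_sq (𝕜 := ℂ) z, inner_re_symm, mem_sphere_zero_iff_norm.1 ω.2]
    simp only [RCLike.re_to_complex]
    ring
  change ((r ^ 2 + ‖z‖ ^ 2 : ℝ) / 2 : ℂ) - 2⁻¹ * (inner ℂ (ω : E) z + conj (inner ℂ (ω : E) z)) = _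
  rw [Complex.add_conj, hnorm]
  push_cast
  ring

/-- The function `ω ↦ -|z - ω|² / 4 + (i/2) Im(z · ω̄)` on the sphere of radius `r`: the exponent in
`twistedLaguerreKernel`. -/
noncomputable def twistedGaussianExponent (r : ℝ) (z : E) : sphere (0 : E) r →ᵇ ℂ :=
  (4⁻¹ : ℂ) • (innerOnSphere r z - star (innerOnSphere r z)) - (2⁻¹ : ℂ) • halfSqDistOnSphere r z

theorem twistedLaguerreKernel_eq (m k : ℕ) (z : E) (ω : sphere (0 : E) r) :
    twistedLaguerreKernel m k z ω =
      (aeval (halfSqDistOnSphere r z) (laguerreSequence m k) *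
        NormedSpace.exp (twistedGaussianExponent r z)) ω := by
  have hexp : twistedGaussianExponent r z ω =
      (-(‖z - ω‖ ^ 2 / 4) : ℝ) + Complex.I / 2 * ((inner ℂ (ω : E) z).im : ℂ) := by
    change 4⁻¹ * (inner ℂ (ω : E) z - conj (inner ℂ (ω : E) z)) -
      2⁻¹ * halfSqDistOnSphere r z ω = _
    rw [halfSqDistOnSphere_apply, Complex.sub_conj]
    push_cast
    ring
  rw [BoundedContinuousFunction.mul_apply, boundedContinuousFunction_aeval_apply,
    boundedContinuousFunction_exp_apply, halfSqDistOnSphere_apply, eval_laguerreSequence, hexp,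
    Complex.exp_add, twistedLaguerreKernel]
  push_cast
  ring

theorem exp_innerOnSphere_add_star_apply (σ : ℝ) (z : E) (ω : sphere (0 : E) r) :
    NormedSpace.exp ((σ * Complex.I / 2) • (innerOnSphere r z + star (innerOnSphere r z))) ω =
      Complex.exp ((σ * (inner ℂ (ω : E) z).re : ℝ) * Complex.I) := by
  rw [boundedContinuousFunction_exp_apply]
  change Complex.exp (σ * Complex.I / 2 * (inner ℂ (ω : E) z + conj (inner ℂ (ω : E) z))) = _
  rw [Complex.add_conj]
  push_cast
  ring_nf

variable (Λ : (sphere (0 : E) r →ᵇ ℂ) →L[ℂ] ℂ) {m : ℕ} {z : E}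

theorem map_exp_innerOnSphere_eq_zero_of_laguerre
    (h : ∀ k, Λ (aeval (halfSqDistOnSphere r z) (laguerreSequence m k) *
      NormedSpace.exp (twistedGaussianExponent r z)) = 0) (τ : ℂ) :
    Λ (NormedSpace.exp
      ((τ + 4⁻¹) • innerOnSphere r z + (τ - 4⁻¹) • star (innerOnSphere r z))) = 0 := by
  have hpow (i : ℕ) : Λ (halfSqDistOnSphere r z ^ i *
      NormedSpace.exp (twistedGaussianExponent r z)) = 0 := by
    simpa using map_aeval_mul_eq_zero (laguerreSequence m) Λ.toLinearMap h (X ^ i)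
  have hzero := map_exp_smul_mul_eq_zero Λ hpow (2⁻¹ - 2 * τ)
  have hexponent : (2⁻¹ - 2 * τ) • halfSqDistOnSphere r z + twistedGaussianExponent r z =
      algebraMap ℂ _ (-τ * (r ^ 2 + ‖z‖ ^ 2 : ℝ)) +
        ((τ + 4⁻¹) • innerOnSphere r z + (τ - 4⁻¹) • star (innerOnSphere r z)) := by
    simp only [twistedGaussianExponent, halfSqDistOnSphere, Algebra.algebraMap_eq_smul_one]
    module
  rw [← NormedSpace.exp_add_of_commute (.all _ _), hexponent,
    NormedSpace.exp_add_of_commute (.all _ _), ← NormedSpace.algebraMap_exp_comm,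
    ← Algebra.smul_def, map_smul, smul_eq_zero] at hzero
  exact hzero.resolve_left (Complex.exp_eq_exp_ℂ ▸ Complex.exp_ne_zero _)

theorem map_exp_innerOnSphere_add_star_eq_zero {r₂ : ℝ}
    (h : ∀ k, ∀ z ∈ sphere (0 : E) r₂, Λ (aeval (halfSqDistOnSphere r z) (laguerreSequence m k) *
      NormedSpace.exp (twistedGaussianExponent r z)) = 0) (hz : z ∈ sphere (0 : E) r₂) (s : ℂ) :
    Λ (NormedSpace.exp (s • (innerOnSphere r z + star (innerOnSphere r z)))) = 0 := by
  refine map_exp_smul_add_eq_zero Λ 4⁻¹ (fun τ ζ hζ ↦ ?_) s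
  have hζz : ζ • z ∈ sphere (0 : E) r₂ := by simpa [norm_smul, hζ] using hz
  have hzero := map_exp_innerOnSphere_eq_zero_of_laguerre Λ (fun k ↦ h k _ hζz) τ
  rwa [innerOnSphere_smul, star_smul, Complex.star_def, ← Complex.inv_eq_conj hζ,
    smul_comm _ ζ, smul_comm _ ζ⁻¹] at hzero

end TwistedConvolution

theorem exists_real_smul_mem_sphere {E : Type*} [NormedAddCommGroup E] [NormedSpace ℝ E]
    [Nontrivial E] {r : ℝ} (hr : 0 < r) (t : E) : ∃ z ∈ sphere (0 : E) r, ∃ σ : ℝ, σ • z = t := by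
  obtain rfl | ht := eq_or_ne t 0
  · obtain ⟨z, hz⟩ := NormedSpace.sphere_nonempty (x := (0 : E)).2 hr.le
    exact ⟨z, hz, 0, zero_smul ℝ z⟩
  · have ht' : ‖t‖ ≠ 0 := norm_ne_zero_iff.2 ht
    refine ⟨(r / ‖t‖) • t, by simp [norm_smul, abs_of_pos hr, ht'], ‖t‖ / r, ?_⟩
    rw [smul_smul, div_mul_div_cancel₀ hr.ne', div_self ht', one_smul]

theorem theorem5p1_general {E : Type*} [NormedAddCommGroup E] [InnerProductSpace ℂ E]
    [CompleteSpace E] [SecondCountableTopology E] [Nontrivial E] [MeasurableSpace E]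
    [BorelSpace E] (m : ℕ) {r₁ r₂ : ℝ} (hr₂ : 0 < r₂) (μ : ComplexMeasure E)
    (hμ : ∀ s, MeasurableSet s → Disjoint s (sphere 0 r₁) → μ s = 0)
    (hvanish : ∀ k : ℕ, ∀ z ∈ sphere (0 : E) r₂,
      ∫ᵛ ω, twistedLaguerreKernel m k z ω ∂[ContinuousLinearMap.mul ℝ ℂ; μ] = 0) : μ = 0 := by
  let _ : InnerProductSpace ℝ E := .complexToReal
  have hK : MeasurableSet (sphere (0 : E) r₁) := isClosed_sphere.measurableSet
  obtain ⟨ν, rfl⟩ := exists_vectorMeasure_map_subtypeVal_eq μ hK hμ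
  simp_rw [(MeasurableEmbedding.subtype_coe hK).integral_map_vectorMeasure,
    twistedLaguerreKernel_eq, ← integralCLM_apply] at hvanish
  refine complexMeasure_eq_zero_of_fourier_eq_zero _ fun t ↦ ?_
  obtain ⟨z, hz, σ, rfl⟩ := exists_real_smul_mem_sphere hr₂ t
  rw [(MeasurableEmbedding.subtype_coe hK).integral_map_vectorMeasure,
    ← map_exp_innerOnSphere_add_star_eq_zero (integralCLM ν) hvanish hz (σ * Complex.I / 2),
    integralCLM_apply]
  simp_rw [exp_innerOnSphere_add_star_apply, real_inner_smul_right, real_inner_eq_re_inner ℂ,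
    RCLike.re_to_complex]

theorem theorem5p1 (n : ℕ) (hn : 1 ≤ n) (r₁ r₂ : ℝ) (hr₁ : 0 < r₁) (hr₂ : 0 < r₂)
    (μ : ComplexMeasure (EuclideanSpace ℂ (Fin n))) (hμ : IsACSphereMeasure n r₁ μ)
    (hvanish : ∀ k : ℕ, ∀ z ∈ Metric.sphere (0 : EuclideanSpace ℂ (Fin n)) r₂,
      spectralProjection n k μ z = 0) :
    μ = 0 := by
  have : NeZero n := ⟨Nat.one_le_iff_ne_zero.1 hn⟩
  exact theorem5p1_general (n - 1) hr₂ μ hμ.supported fun k z hz ↦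
    (spectralProjection_eq_integral n k μ z).symm.trans (hvanish k z hz)
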